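/- Let $F$ be a field of characteristic $2$ and let $n\ge 2$. For $a,b\in F$ let $[a,b]$ denote the quadratic form $(u,v)\mapsto au^2+uv+bv^2$ on $F^2$. For $c_1,\dots,c_m\in F^\times$ let $\langle\langle c_1,\dots,c_m\rangle\rangle=\langle 1,c_1\rangle\otimes\cdots\otimes\langle 1,c_m\rangle$ be the bilinear $m$-fold Pfister form, and for $x\in F$ let $$\langle\langle c_1,\dots,c_m,x]]=\langle\langle c_1,\dots,c_m\rangle\rangle\otimes[1,x]$$ be the quadratic $(m+1)$-fold Pfister form, where $\langle w_1,\dots,w_r\rangle\otimes q=w_1q\perp\dots\perp w_rq$. Two quadratic $n$-fold Pfister forms $\varphi,\psi$ over $F$ are called left-linked if there are a bilinear $(n-1)$-fold Pfister form $b$ and elements $x,y\in F$ with $\varphi\simeq b\otimes[1,x]$ and $\psi\simeq b\otimes[1,y]$. A quadratic form is hyperbolic if it is isometric to an orthogonal sum of finitely many copies of the hyperbolic plane $(u,v)\mapsto uv$. Theorem. Let $\beta,\gamma,\alpha_1,\dots,\alpha_{n-2}\in F^\times$ and $\alpha_{n-1}\in F$. The two quadratic $n$-fold Pfister forms $$\varphi=\langle\langle\beta,\alpha_1,\dots,\alpha_{n-1}]],\qquad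 \psi=\langle\langle\gamma,\alpha_1,\dots,\alpha_{n-1}]]$$ (which are right-linked: they share the right divisor $\langle\langle\alpha_1,\dots,\alpha_{n-1}]]$) are left-linked if and only if the quadratic $(n+1)$-fold Pfister form $\langle\langle\gamma,\beta,\alpha_1,\dots,\alpha_{n-1}]]$ is hyperbolic. -/

import Mathlib

namespace QuadPfister

/-- The binary quadratic form `[a, b] : (u, v) ↦ a u² + u v + b v²` on `F²`. -/
def binaryForm {F : Type*} [Field F] (a b : F) : QuadraticForm F (F × F) :=
  a • QuadraticMap.linMulLin (LinearMap.fst F F F) (LinearMap.fst F F F) +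
    QuadraticMap.linMulLin (LinearMap.fst F F F) (LinearMap.snd F F F) +
    b • QuadraticMap.linMulLin (LinearMap.snd F F F) (LinearMap.snd F F F)

/-- The tensor product `⟨w₁, …, w_r⟩ ⊗ Q = w₁ Q ⊥ … ⊥ w_r Q` of a diagonal bilinear form
with nonzero entries `w i` and a quadratic form `Q`. -/
def diagTensor {F M ι : Type*} [Field F] [AddCommGroup M] [Module F M] [Fintype ι]
    (w : ι → Fˣ) (Q : QuadraticForm F M) : QuadraticForm F (ι → M) :=
  QuadraticMap.pi fun i => (w i : F) • Q

/-- The diagonal entries of the bilinear `m`-fold Pfister form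
`⟨⟨c₁, …, c_m⟩⟩ = ⟨1, c₁⟩ ⊗ ⋯ ⊗ ⟨1, c_m⟩`, in the tensor basis: the basis vector labelled by
`e ∈ {0,1}^m` has the entry `c₁ ^ e₁ ⋯ c_m ^ e_m`. (For `m = 0` this is `⟨1⟩`.) -/
def bilinPfister {F : Type*} [Field F] {m : ℕ} (c : Fin m → Fˣ) : (Fin m → Fin 2) → Fˣ :=
  fun e => ∏ i, c i ^ (e i : ℕ)

/-- The quadratic `(m + 1)`-fold Pfister form
`⟨⟨c₁, …, c_m, a]] = ⟨⟨c₁, …, c_m⟩⟩ ⊗ [1, a]`. -/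
def quadPfister {F : Type*} [Field F] {m : ℕ} (c : Fin m → Fˣ) (a : F) :
    QuadraticForm F ((Fin m → Fin 2) → F × F) :=
  diagTensor (bilinPfister c) (binaryForm 1 a)

/-- A quadratic form is hyperbolic if it is isometric to an orthogonal sum of finitely many
hyperbolic planes `(u, v) ↦ u v`. -/
def IsHyperbolic {F M : Type*} [Field F] [AddCommGroup M] [Module F M]
    (Q : QuadraticForm F M) : Prop :=
  ∃ k : ℕ, Q.Equivalent (QuadraticMap.pi fun _ : Fin k => binaryForm (0 : F) 0)

/-- A set `S` of quadratic `n`-fold Pfister forms is left-linked if there is one bilinear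
`(n - 1)`-fold Pfister form `b = ⟨⟨c₁, …, c_{n-1}⟩⟩` such that each member of `S` is isometric to
`b ⊗ [1, x]` for some quadratic `1`-fold Pfister form `[1, x]`. -/
def IsLeftLinked {F M : Type*} [Field F] [AddCommGroup M] [Module F M] (n : ℕ)
    (S : Set (QuadraticForm F M)) : Prop :=
  ∃ c : Fin (n - 1) → Fˣ, ∀ φ ∈ S, ∃ x : F,
    φ.Equivalent (diagTensor (bilinPfister c) (binaryForm 1 x))

end QuadPfister

/-!
Write `π = ⟨⟨α₁, …, α_{n-2}, a]]`, so that the two forms are `⟨1, β⟩ ⊗ π` and `⟨1, γ⟩ ⊗ π`, and the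
`(n + 1)`-fold form is `⟨1, γ⟩ ⊗ ⟨1, β⟩ ⊗ π`. Two facts of Pfister's theory are used: quadratic
Pfister forms are round (`isRound_quadPfister`), and isotropic ones are hyperbolic
(`isHyperbolic_quadPfister`). By the second, hyperbolic may be read as isotropic for the
`(n + 1)`-fold form.

Suppose it is isotropic (`exists_equivalent_of_not_anisotropic`). If one of the two `n`-fold forms
is isotropic, it is hyperbolic, hence isometric to `b ⊗ [1, 0]` for every bilinear Pfister form `b`
of the right dimension, in particular for the one dividing the other form. Otherwise roundness makes
`γ` a value of `⟨1, β⟩ ⊗ π`, say `γ = r + β t` with `r` and `t` values of `π`. The cases `r = 0` and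
`t = 0` are easy. In the remaining case `r` and `t` are similarity factors of `π`, so that `β` and
`γ` may be replaced by `β t / r` and `γ / r`, that is, `γ = 1 + β` may be assumed. Then the isometry
`⟨1, β⟩ ⊗ [1, a] ≃ ⟨1, 1 + β⟩ ⊗ [1, a (1 + β) / β]` (`equivalent_binaryForm_one_add`) shows that
`⟨⟨1 + β, α₁, …, α_{n-2}⟩⟩` divides both forms.

Conversely, suppose that `b` divides both forms (`not_anisotropic_of_equivalent`). Then the
totally singular form `h(s) = b(s, s)`, of dimension `dim π`, embeds in both, by `(i₁, i₂)` and
`(j₁, j₂)` say; and `h(e) = 1` for some `e`. If `⟨β, γ⟩ ⊗ π` is isotropic, so is the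
`(n + 1)`-fold form, which contains it. If it is anisotropic, a dimension count with the nondegenerate
polar form of `π` provides `s` with `i₁ s = j₁ (s + e)`
(`exists_add_eq_one_of_common_subform`). As `h` is additive,
`1 = h(s) + h(s + e) = β π(i₂ s) + γ π(j₂ (s + e))`. So `⟨β, γ⟩ ⊗ π` represents `1`, as `π` does,
and `⟨1, β, γ⟩ ⊗ π` is isotropic. No cancellation theorem is needed.
-/

open QuadraticMap

namespace QuadPfister

/-! ### Isometries of scaled and tensored forms -/

section Isometry

variable {F M M' N ι : Type*} [Field F] [AddCommGroup M] [Module F M] [AddCommGroup M']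
  [Module F M'] [AddCommGroup N] [Module F N] [Fintype ι]

@[simp]
theorem binaryForm_apply (a b : F) (x : F × F) :
    binaryForm a b x = a * x.1 ^ 2 + x.1 * x.2 + b * x.2 ^ 2 := by
  simp [binaryForm]; ring

@[simp]
theorem diagTensor_apply (w : ι → Fˣ) (Q : QuadraticForm F M) (x : ι → M) :
    diagTensor w Q x = ∑ i, (w i : F) * Q (x i) := by
  simp [diagTensor]

theorem equivalent_smul (c : F) {Q : QuadraticForm F M} {Q' : QuadraticForm F M'}
    (h : Q.Equivalent Q') : (c • Q).Equivalent (c • Q') := by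
  obtain ⟨e⟩ := h
  exact ⟨{ e.toLinearEquiv with
    map_app' := fun x => congrArg (c * ·) (e.map_app x) }⟩

/-- Scaling vectors by `c` shows `c² Q ≃ Q`. -/
theorem equivalent_sq_smul {c : F} (hc : c ≠ 0) (Q : QuadraticForm F M) :
    ((c * c) • Q).Equivalent Q :=
  ⟨{ LinearEquiv.smulOfNeZero F M c hc with
    map_app' := fun x => by
      change Q (c • x) = _
      rw [QuadraticMap.map_smul]; rfl }⟩

theorem equivalent_diagTensor (w : ι → Fˣ) {Q : QuadraticForm F M} {Q' : QuadraticForm F M'}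
    (h : Q.Equivalent Q') : (diagTensor w Q).Equivalent (diagTensor w Q') :=
  QuadraticMap.Equivalent.pi fun _ => equivalent_smul _ h

theorem smul_diagTensor (c : F) (w : ι → Fˣ) (Q : QuadraticForm F M) :
    c • diagTensor w Q = diagTensor w (c • Q) := by
  ext x
  simp [Finset.mul_sum, mul_left_comm]

theorem smul_prod (c : F) (Q : QuadraticForm F M) (Q' : QuadraticForm F N) :
    c • Q.prod Q' = (c • Q).prod (c • Q') := by
  ext x
  simp [mul_add]

theorem equivalent_diagTensor_prod (w : ι → Fˣ) (Q : QuadraticForm F M)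
    (Q' : QuadraticForm F N) :
    (diagTensor w (Q.prod Q')).Equivalent ((diagTensor w Q).prod (diagTensor w Q')) :=
  ⟨{  toFun := fun f => (fun i => (f i).1, fun i => (f i).2)
      invFun := fun g i => (g.1 i, g.2 i)
      map_add' := fun _ _ => rfl
      map_smul' := fun _ _ => rfl
      left_inv := fun _ => rfl
      right_inv := fun _ => rfl
      map_app' := fun f => by simp [mul_add, Finset.sum_add_distrib] }⟩

theorem bilinPfister_cons {m : ℕ} (c : Fˣ) (α : Fin m → Fˣ) (k : Fin 2) (e : Fin m → Fin 2) :
    bilinPfister (Fin.cons c α : Fin (m + 1) → Fˣ) (Fin.cons k e) =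
      c ^ (k : ℕ) * bilinPfister α e := by
  simp [bilinPfister, Fin.prod_univ_succ]

/-- `⟨⟨c, α₁, …, α_m⟩⟩ ⊗ Q ≃ R ⊥ c R` for `R = ⟨⟨α₁, …, α_m⟩⟩ ⊗ Q`. -/
theorem equivalent_diagTensor_cons {m : ℕ} (c : Fˣ) (α : Fin m → Fˣ) (Q : QuadraticForm F M) :
    (diagTensor (bilinPfister (Fin.cons c α : Fin (m + 1) → Fˣ)) Q).Equivalent
      ((diagTensor (bilinPfister α) Q).prod ((c : F) • diagTensor (bilinPfister α) Q)) :=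
  ⟨{  toFun := fun f => (fun e => f (Fin.cons 0 e), fun e => f (Fin.cons 1 e))
      invFun := fun g e => if e 0 = 0 then g.1 (Fin.tail e) else g.2 (Fin.tail e)
      map_add' := fun _ _ => rfl
      map_smul' := fun _ _ => rfl
      left_inv := fun f => by
        funext e
        have h' := Fin.cons_self_tail e
        rcases Fin.exists_fin_two.1 ⟨e 0, rfl⟩ with h | h <;> rw [h] at h' <;> simp [h, h']
      right_inv := fun g => by simp
      map_app' := fun f => by
        simp only [prod_apply, diagTensor_apply, _root_.smul_apply, smul_eq_mul,
          Finset.mul_sum]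
        rw [← (Fin.consEquiv fun _ : Fin (m + 1) => Fin 2).sum_comp, Fintype.sum_prod_type,
          Fin.sum_univ_two]
        simp [Fin.consEquiv, bilinPfister_cons, mul_assoc] }⟩

/-- The isometry `⟨r, s⟩ ≃ ⟨r + s, r s (r + s)⟩` of binary bilinear forms, tensored with `Q`. -/
theorem equivalent_prod_smul_add {r s : F} (h : r + s ≠ 0) (Q : QuadraticForm F M) :
    ((r • Q).prod (s • Q)).Equivalent (((r + s) • Q).prod ((r * s * (r + s)) • Q)) := by
  refine QuadraticMap.Equivalent.symm ⟨{
      toFun := fun x => (x.1 + s • x.2, x.1 - r • x.2)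
      invFun := fun y => ((r + s)⁻¹ • (r • y.1 + s • y.2), (r + s)⁻¹ • (y.1 - y.2))
      map_add' := fun x y => by ext <;> simp <;> module
      map_smul' := fun c x => by ext <;> simp <;> module
      left_inv := fun x => by
        ext <;> simp only <;> match_scalars <;> field_simp <;> ring
      right_inv := fun x => by
        ext <;> simp only <;> match_scalars <;> field_simp <;> ring
      map_app' := fun x => ?_ }⟩
  simp only [prod_apply, _root_.smul_apply, smul_eq_mul]
  rw [sub_eq_add_neg, QuadraticMap.map_add Q, QuadraticMap.map_add Q, ← neg_smul,
    QuadraticMap.map_smul, QuadraticMap.map_smul, QuadraticMap.polar_smul_right,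
    QuadraticMap.polar_smul_right]
  simp only [smul_eq_mul]
  ring

theorem anisotropic_of_equivalent {Q : QuadraticForm F M} {Q' : QuadraticForm F N}
    (h : Q.Equivalent Q') (hQ : Q.Anisotropic) : Q'.Anisotropic := by
  obtain ⟨e⟩ := h
  intro x hx
  have := hQ (e.symm x) (by rw [e.symm.map_app, hx])
  simpa using this

theorem exists_of_not_anisotropic_prod_smul {c : F} {Q : QuadraticForm F M}
    (h : ¬ (Q.prod (c • Q)).Anisotropic) :
    ∃ u v, Q u + c * Q v = 0 ∧ ¬ (u = 0 ∧ v = 0) := by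
  contrapose! h
  rintro ⟨u, v⟩ h0
  have := h u v h0
  exact Prod.ext this.1 this.2

end Isometry

/-! ### Hyperbolic forms -/

section Hyperbolic

variable {F M N ι : Type*} [Field F] [AddCommGroup M] [Module F M]
  [AddCommGroup N] [Module F N] [Fintype ι]

theorem IsHyperbolic.of_equivalent {Q : QuadraticForm F M} {Q' : QuadraticForm F N}
    (hQ : IsHyperbolic Q) (h : Q'.Equivalent Q) : IsHyperbolic Q' :=
  hQ.imp fun _ hk => h.trans hk

theorem isHyperbolic_pi :
    IsHyperbolic (QuadraticMap.pi fun _ : ι => binaryForm (0 : F) 0) := by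
  refine ⟨Fintype.card ι, ⟨{
    LinearEquiv.funCongrLeft F (F × F) (Fintype.equivFin ι).symm with
    map_app' := fun f => ?_ }⟩⟩
  simp only [QuadraticMap.pi_apply]
  exact (Fintype.equivFin ι).symm.sum_comp fun i => binaryForm (0 : F) 0 (f i)

theorem equivalent_smul_hyperbolicPlane {c : F} (hc : c ≠ 0) :
    (c • binaryForm (0 : F) 0).Equivalent (binaryForm 0 0) :=
  ⟨{  toFun := fun x => (c * x.1, x.2)
      invFun := fun x => (c⁻¹ * x.1, x.2)
      map_add' := fun x y => by ext <;> simp [mul_add]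
      map_smul' := fun d x => by ext <;> simp [mul_left_comm]
      left_inv := fun x => by ext <;> simp [hc]
      right_inv := fun x => by ext <;> simp [hc]
      map_app' := fun x => by simp; ring }⟩

theorem isHyperbolic_diagTensor (w : ι → Fˣ) {Q : QuadraticForm F M}
    (h : Q.Equivalent (binaryForm (0 : F) 0)) : IsHyperbolic (diagTensor w Q) :=
  isHyperbolic_pi.of_equivalent <| QuadraticMap.Equivalent.pi fun i =>
    (equivalent_smul _ h).trans (equivalent_smul_hyperbolicPlane (w i).ne_zero)

theorem IsHyperbolic.smul {Q : QuadraticForm F M} (hQ : IsHyperbolic Q) {c : F} (hc : c ≠ 0) :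
    IsHyperbolic (c • Q) := by
  obtain ⟨k, hk⟩ := hQ
  refine ⟨k, (equivalent_smul c hk).trans ?_⟩
  have : c • QuadraticMap.pi (fun _ : Fin k => binaryForm (0 : F) 0) =
      QuadraticMap.pi fun _ : Fin k => c • binaryForm (0 : F) 0 := by
    ext x
    simp [Finset.mul_sum]
  rw [this]
  exact QuadraticMap.Equivalent.pi fun _ => equivalent_smul_hyperbolicPlane hc

theorem IsHyperbolic.prod {Q : QuadraticForm F M} {Q' : QuadraticForm F N}
    (hQ : IsHyperbolic Q) (hQ' : IsHyperbolic Q') : IsHyperbolic (Q.prod Q') := by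
  obtain ⟨k, hk⟩ := hQ
  obtain ⟨l, hl⟩ := hQ'
  refine (isHyperbolic_pi (F := F) (ι := Fin k ⊕ Fin l)).of_equivalent
    ((hk.prod hl).trans (QuadraticMap.Equivalent.symm ⟨{
      LinearEquiv.sumArrowLequivProdArrow (Fin k) (Fin l) F (F × F) with
      map_app' := fun f => ?_ }⟩))
  simp only [prod_apply, QuadraticMap.pi_apply, Fintype.sum_sum_type]
  rfl

theorem IsHyperbolic.equivalent {Q : QuadraticForm F M} {Q' : QuadraticForm F N}
    (hQ : IsHyperbolic Q) (hQ' : IsHyperbolic Q')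
    (h : Module.finrank F M = Module.finrank F N) : Q.Equivalent Q' := by
  obtain ⟨k, ⟨e⟩⟩ := hQ
  obtain ⟨l, ⟨e'⟩⟩ := hQ'
  have hk := e.toLinearEquiv.finrank_eq
  have hl := e'.toLinearEquiv.finrank_eq
  simp only [Module.finrank_pi_fintype, Module.finrank_prod, Module.finrank_self,
    Finset.sum_const, Finset.card_univ, Fintype.card_fin, smul_eq_mul] at hk hl
  obtain rfl : k = l := by omega
  exact ⟨e.trans e'.symm⟩

theorem IsHyperbolic.not_anisotropic [Nontrivial M] {Q : QuadraticForm F M}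
    (hQ : IsHyperbolic Q) : ¬ Q.Anisotropic := by
  obtain ⟨k, ⟨e⟩⟩ := hQ
  intro hA
  have hA' := anisotropic_of_equivalent ⟨e⟩ hA
  obtain ⟨x, hx⟩ := exists_ne (0 : M)
  have hx' : e x ≠ 0 := fun h => hx (by simpa using congrArg e.symm h)
  obtain ⟨i, -⟩ := Function.ne_iff.1 hx'
  have h0 := QuadraticMap.anisotropic_of_pi hA' i (1, 0) (by simp)
  simp at h0

end Hyperbolic

/-! ### Pfister forms in characteristic two -/

section Pfister

variable {F M N ι : Type*} [Field F] [AddCommGroup M] [Module F M]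
  [AddCommGroup N] [Module F N] [Fintype ι]

/-- A quadratic form is round if each of its nonzero values is a similarity factor. -/
def IsRound (Q : QuadraticForm F M) : Prop :=
  ∀ x, Q x ≠ 0 → (Q x • Q).Equivalent Q

theorem IsRound.of_equivalent {Q : QuadraticForm F M} {Q' : QuadraticForm F N}
    (hQ : IsRound Q) (h : Q'.Equivalent Q) : IsRound Q' := by
  obtain ⟨e⟩ := h
  intro x hx
  rw [← e.map_app] at hx ⊢
  exact ((equivalent_smul _ ⟨e⟩).trans (hQ _ hx)).trans ⟨e.symm⟩

theorem equivalent_inv_smul {c : F} (hc : c ≠ 0) {Q : QuadraticForm F M}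
    (h : (c • Q).Equivalent Q) : (c⁻¹ • Q).Equivalent Q := by
  have := equivalent_smul c⁻¹ h
  rw [smul_smul, inv_mul_cancel₀ hc, one_smul] at this
  exact this.symm

theorem equivalent_mul_smul {c d : F} {Q : QuadraticForm F M}
    (hc : (c • Q).Equivalent Q) (hd : (d • Q).Equivalent Q) :
    ((c * d) • Q).Equivalent Q := by
  rw [← smul_smul]
  exact (equivalent_smul c hd).trans hc

/-- `⟨1, c⟩ ⊗ Q` is unchanged when `c` is multiplied by a similarity factor of `Q`. -/
theorem equivalent_prod_smul_mul (c : F) {t : F} {Q : QuadraticForm F M}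
    (ht : (t • Q).Equivalent Q) :
    (Q.prod ((c * t) • Q)).Equivalent (Q.prod (c • Q)) := by
  rw [← smul_smul]
  exact (QuadraticMap.Equivalent.refl _).prod (equivalent_smul c ht)

/-- Pfister's argument: `⟨1, c⟩ ⊗ Q` is round if `Q` is. If `r` and `t` are nonzero values of `Q`
and `r + c t ≠ 0`, then `⟨1, c⟩ ⊗ Q ≃ ⟨r, c t⟩ ⊗ Q ≃ (r + c t) ⟨1, c⟩ ⊗ Q`. -/
theorem IsRound.prod_smul {Q : QuadraticForm F M} (hQ : IsRound Q) {c : F} (hc : c ≠ 0) :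
    IsRound (Q.prod (c • Q)) := by
  rintro ⟨u, v⟩ h
  simp only [prod_apply, _root_.smul_apply, smul_eq_mul] at h ⊢
  by_cases hv : Q v = 0
  · rw [hv, mul_zero, add_zero] at h ⊢
    rw [smul_prod, smul_comm]
    exact (hQ u h).prod (equivalent_smul c (hQ u h))
  by_cases hu : Q u = 0
  · rw [hu, zero_add] at h ⊢
    rw [smul_prod]
    refine QuadraticMap.Equivalent.trans ?_ ⟨IsometryEquiv.prodComm _ _⟩
    refine QuadraticMap.Equivalent.prod ?_ ?_
    · rw [← smul_smul]
      exact equivalent_smul c (hQ v hv)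
    · rw [smul_smul, mul_right_comm, ← smul_smul]
      exact (equivalent_sq_smul hc _).trans (hQ v hv)
  · rw [smul_prod]
    have h1 : (Q.prod (c • Q)).Equivalent ((Q u • Q).prod ((c * Q v) • Q)) := by
      rw [← smul_smul]
      exact (hQ u hu).symm.prod (equivalent_smul c (hQ v hv).symm)
    refine ((h1.trans (equivalent_prod_smul_add h Q)).trans ?_).symm
    refine (QuadraticMap.Equivalent.refl _).prod ?_
    rw [show Q u * (c * Q v) * (Q u + c * Q v) = ((Q u + c * Q v) * c) * (Q u * Q v) by ring,
      ← smul_smul, smul_smul _ c]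
    exact equivalent_smul _ (equivalent_mul_smul (hQ u hu) (hQ v hv))

theorem equivalent_diagTensor_zero (α : Fin 0 → Fˣ) (Q : QuadraticForm F M) :
    (diagTensor (bilinPfister α) Q).Equivalent Q :=
  ⟨{  LinearEquiv.funUnique (Fin 0 → Fin 2) F M with
      map_app' := fun f => by
        simp [bilinPfister] }⟩

theorem equivalent_quadPfister_cons {m : ℕ} (c : Fˣ) (α : Fin m → Fˣ) (a : F) :
    (quadPfister (Fin.cons c α : Fin (m + 1) → Fˣ) a).Equivalent
      ((quadPfister α a).prod ((c : F) • quadPfister α a)) :=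
  equivalent_diagTensor_cons c α _

theorem exists_quadPfister_eq_one {m : ℕ} (α : Fin m → Fˣ) (a : F) :
    ∃ x, quadPfister α a x = 1 := by
  classical
  refine ⟨Pi.single 0 (1, 0), ?_⟩
  rw [quadPfister, diagTensor, QuadraticMap.pi_apply_single]
  simp [bilinPfister]

variable [CharP F 2]

/-- The form `[1, a]` is the norm form of `F[θ]` with `θ² = θ + a`, and multiplication by
`u + v θ` is a similarity with factor its norm. -/
theorem isRound_binaryForm (a : F) : IsRound (binaryForm 1 a) := by
  rintro ⟨u, v⟩ h
  have h2 : (2 : F) = 0 := CharTwo.two_eq_zero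
  simp only [binaryForm_apply, one_mul] at h ⊢
  exact ⟨{
    toFun := fun x => (u * x.1 + a * v * x.2, u * x.2 + v * x.1 + v * x.2)
    invFun := fun x => ((u ^ 2 + u * v + a * v ^ 2)⁻¹ * ((u + v) * x.1 + a * v * x.2),
      (u ^ 2 + u * v + a * v ^ 2)⁻¹ * ((u + v) * x.2 + v * x.1 + v * x.2))
    map_add' := fun x y => by ext <;> simp <;> ring
    map_smul' := fun c x => by ext <;> simp <;> ring
    left_inv := fun x => by
      ext
      · simp only
        rw [inv_mul_eq_iff_eq_mul₀ h]
        linear_combination (a * u * v * x.2 + a * v ^ 2 * x.2) * h2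
      · simp only
        rw [inv_mul_eq_iff_eq_mul₀ h]
        linear_combination (u * v * x.1 + u * v * x.2 + v ^ 2 * x.2 + v ^ 2 * x.1) * h2
    right_inv := fun x => by
      ext
      · simp only
        linear_combination (u ^ 2 + u * v + a * v ^ 2)⁻¹ *
          (a * u * v * x.2 + a * v ^ 2 * x.2) * h2 + x.1 * mul_inv_cancel₀ h
      · simp only
        linear_combination (u ^ 2 + u * v + a * v ^ 2)⁻¹ *
          (u * v * x.1 + u * v * x.2 + v ^ 2 * x.2 + v ^ 2 * x.1) * h2 + x.2 * mul_inv_cancel₀ h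
    map_app' := fun x => by
      simp
      linear_combination (2 * a * u * v * x.1 * x.2 + a * v ^ 2 * x.1 * x.2 +
        a * u * v * x.2 ^ 2 + a * v ^ 2 * x.2 ^ 2) * h2 }⟩

theorem isRound_quadPfister {m : ℕ} (α : Fin m → Fˣ) (a : F) : IsRound (quadPfister α a) := by
  induction m with
  | zero => exact (isRound_binaryForm a).of_equivalent (equivalent_diagTensor_zero α _)
  | succ m ih =>
    rw [← Fin.cons_self_tail α]
    exact ((ih (Fin.tail α)).prod_smul (α 0).ne_zero).of_equivalent
      (equivalent_quadPfister_cons _ _ _)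

/-- A nontrivial zero of `[1, a]` gives `a = s² + s`, and then
`[1, a] = (u + s v) (u + (s + 1) v)`. -/
theorem equivalent_hyperbolicPlane_of_not_anisotropic {a : F}
    (h : ¬ (binaryForm 1 a).Anisotropic) : (binaryForm 1 a).Equivalent (binaryForm (0 : F) 0) := by
  have h2 : (2 : F) = 0 := CharTwo.two_eq_zero
  simp only [QuadraticMap.Anisotropic, not_forall] at h
  obtain ⟨⟨u, v⟩, h, hne⟩ := h
  simp only [binaryForm_apply, one_mul] at h
  have hv : v ≠ 0 := by
    rintro rfl
    simp_all
  obtain ⟨s, rfl⟩ : ∃ s, a = s ^ 2 + s := by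
    refine ⟨u / v, ?_⟩
    field_simp
    linear_combination h - (u ^ 2 + u * v) * h2
  exact ⟨{
    toFun := fun x => (x.1 + s * x.2, x.1 + (s + 1) * x.2)
    invFun := fun y => ((s + 1) * y.1 + s * y.2, y.1 + y.2)
    map_add' := fun x y => by ext <;> simp <;> ring
    map_smul' := fun c x => by ext <;> simp <;> ring
    left_inv := fun x => by
      ext
      · simp only
        linear_combination (s * x.1 + (s ^ 2 + s) * x.2) * h2
      · simp only
        linear_combination (x.1 + s * x.2) * h2
    right_inv := fun x => by
      ext
      · simp only
        linear_combination (s * x.1 + s * x.2) * h2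
      · simp only
        linear_combination ((s + 1) * x.1 + s * x.2) * h2
    map_app' := fun x => by
      simp
      linear_combination (s * x.1 * x.2) * h2 }⟩

/-- In characteristic two, `[1, a] ⊥ [1, a]` is the sum of two hyperbolic planes. -/
theorem equivalent_binaryForm_prod_self (a : F) :
    ((binaryForm 1 a).prod (binaryForm 1 a)).Equivalent
      ((binaryForm (0 : F) 0).prod (binaryForm 0 0)) := by
  have h2 : (2 : F) = 0 := CharTwo.two_eq_zero
  exact ⟨{
    toFun := fun x => ((x.1.1 + x.2.1, x.1.1 + x.2.1 + x.1.2),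
      (x.1.2 + x.2.2, x.2.1 + a * (x.1.2 + x.2.2)))
    invFun := fun y => ((y.1.1 + (y.2.2 + a * y.2.1), y.1.1 + y.1.2),
      (y.2.2 + a * y.2.1, y.2.1 + y.1.1 + y.1.2))
    map_add' := fun x y => by ext <;> simp <;> ring
    map_smul' := fun c x => by ext <;> simp <;> ring
    left_inv := fun x => by
      ext
      · simp only; linear_combination (x.2.1 + a * (x.1.2 + x.2.2)) * h2
      · simp only; linear_combination (x.1.1 + x.2.1) * h2
      · simp only; linear_combination (a * (x.1.2 + x.2.2)) * h2
      · simp only; linear_combination (x.1.2 + x.1.1 + x.2.1) * h2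
    right_inv := fun y => by
      ext
      · simp only; linear_combination (y.2.2 + a * y.2.1) * h2
      · simp only; linear_combination (y.2.2 + a * y.2.1 + y.1.1) * h2
      · simp only; linear_combination (y.1.1 + y.1.2) * h2
      · simp only; linear_combination (a * (y.2.1 + y.1.1 + y.1.2)) * h2
    map_app' := fun x => by
      simp
      linear_combination (x.1.1 * x.2.1 + x.1.2 * x.2.1 + a * x.1.2 * x.2.2) * h2 }⟩

theorem isHyperbolic_quadPfister_prod_self {m : ℕ} (α : Fin m → Fˣ) (a : F) :
    IsHyperbolic ((quadPfister α a).prod (quadPfister α a)) := by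
  have hH : IsHyperbolic (diagTensor (bilinPfister α) (binaryForm (0 : F) 0)) :=
    isHyperbolic_diagTensor _ (QuadraticMap.Equivalent.refl _)
  refine (hH.prod hH).of_equivalent ?_
  exact (equivalent_diagTensor_prod _ _ _).symm.trans
    ((equivalent_diagTensor _ (equivalent_binaryForm_prod_self a)).trans
      (equivalent_diagTensor_prod _ _ _))

/-- An isotropic quadratic Pfister form is hyperbolic. -/
theorem isHyperbolic_quadPfister {m : ℕ} (α : Fin m → Fˣ) (a : F)
    (h : ¬ (quadPfister α a).Anisotropic) : IsHyperbolic (quadPfister α a) := by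
  induction m with
  | zero =>
    refine isHyperbolic_diagTensor _ (equivalent_hyperbolicPlane_of_not_anisotropic fun h' => h ?_)
    exact anisotropic_of_equivalent (equivalent_diagTensor_zero α _).symm h'
  | succ m ih =>
    obtain ⟨c, α, rfl⟩ : ∃ (c : Fˣ) (α' : Fin m → Fˣ), α = Fin.cons c α' :=
      ⟨α 0, Fin.tail α, (Fin.cons_self_tail α).symm⟩
    have e := equivalent_quadPfister_cons c α a
    by_cases hA : (quadPfister α a).Anisotropic
    · have h' := fun h' => h (anisotropic_of_equivalent e.symm h')
      obtain ⟨u, v, h0, hne⟩ := exists_of_not_anisotropic_prod_smul h'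
      have hv : quadPfister α a v ≠ 0 := fun hv => by
        rw [hv, mul_zero, add_zero] at h0
        exact hne ⟨hA u h0, hA v hv⟩
      have hu : quadPfister α a u = c * quadPfister α a v := CharTwo.add_eq_zero.1 h0
      -- `c` is a quotient of two values of a round form, hence a similarity factor.
      have hc : ((c : F) • quadPfister α a).Equivalent (quadPfister α a) := by
        have hR := isRound_quadPfister α a
        have := equivalent_mul_smul (hR u (by rw [hu]; exact mul_ne_zero c.ne_zero hv))
          (equivalent_inv_smul hv (hR v hv))
        rwa [hu, mul_inv_cancel_right₀ hv] at this
      exact (isHyperbolic_quadPfister_prod_self α a).of_equivalent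
        (e.trans ((QuadraticMap.Equivalent.refl _).prod hc))
    · exact ((ih α hA).prod ((ih α hA).smul c.ne_zero)).of_equivalent e

/-- An isotropic quadratic Pfister form is divisible by every bilinear Pfister form `⟨⟨d₁, …, d_m⟩⟩`
of the right dimension, both it and `⟨⟨d₁, …, d_m⟩⟩ ⊗ [1, 0]` being hyperbolic. -/
theorem equivalent_quadPfister_zero_of_not_anisotropic {m : ℕ} {α : Fin m → Fˣ} {a : F}
    (h : ¬ (quadPfister α a).Anisotropic) (d : Fin m → Fˣ) :
    (quadPfister α a).Equivalent (quadPfister d 0) := by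
  refine (isHyperbolic_quadPfister α a h).equivalent
    (isHyperbolic_quadPfister d 0 fun hA => ?_) rfl
  obtain ⟨i⟩ : Nonempty (Fin m → Fin 2) := inferInstance
  have := QuadraticMap.anisotropic_of_pi hA i (0, 1) (by simp)
  simp at this

/-- The exchange of slots `⟨1, b⟩ ⊗ [1, a] ≃ ⟨1, 1 + b⟩ ⊗ [1, a (1 + b) / b]`: the vectors
`(1, 0, 0, 0)` and `(1, 0, 1, 0)` of the left side are orthogonal with values `1` and `1 + b`. -/
theorem equivalent_binaryForm_one_add {b : F} (hb : b ≠ 0) (hb' : 1 + b ≠ 0) (a : F) :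
    ((binaryForm 1 a).prod (b • binaryForm 1 a)).Equivalent
      ((binaryForm 1 (a * (1 + b) / b)).prod ((1 + b) • binaryForm 1 (a * (1 + b) / b))) := by
  have h2 : (2 : F) = 0 := CharTwo.two_eq_zero
  -- The columns of the map are an orthogonal basis adapted to the right side.
  refine QuadraticMap.Equivalent.symm ⟨{
    toFun := fun x => ((x.1.1 + x.2.1, x.1.2), (x.2.1, (x.1.2 + (1 + b) * x.2.2) / b))
    invFun := fun y => ((y.1.1 + y.2.1, y.1.2), (y.2.1, (b * y.2.2 + y.1.2) / (1 + b)))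
    map_add' := fun x y => by ext <;> simp <;> ring
    map_smul' := fun c x => by ext <;> simp <;> ring
    left_inv := fun x => by
      ext
      · simp only; linear_combination x.2.1 * h2
      · simp only
      · simp only
      · simp only; field_simp; linear_combination x.1.2 * h2
    right_inv := fun y => by
      ext
      · simp only; linear_combination y.2.1 * h2
      · simp only
      · simp only
      · simp only; field_simp; linear_combination y.1.2 * h2
    map_app' := fun x => ?_ }⟩
  simp
  field_simp
  linear_combination (b * (x.1.1 * x.2.1 + x.2.1 * x.1.2) + a * x.1.2 * (1 + b) * x.2.2) * h2

end Pfister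

/-! ### From an isotropic Pfister form to left linkage -/

section Linkage

variable {F : Type*} [Field F] [CharP F 2]

/-- `⟨1, b⟩ ⊗ ⟨⟨α₁, …, α_m, a]]` and `⟨1, 1 + b⟩ ⊗ ⟨⟨α₁, …, α_m, a]]` are both divisible by
`⟨⟨1 + b, α₁, …, α_m⟩⟩`; this is the statement for the first of them. -/
theorem equivalent_prod_smul_quadPfister_one_add {m : ℕ} {b : F} (hb : b ≠ 0) (d : Fˣ)
    (hd : (d : F) = 1 + b) (α : Fin m → Fˣ) (a : F) :
    ((quadPfister α a).prod (b • quadPfister α a)).Equivalent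
      (quadPfister (Fin.cons d α : Fin (m + 1) → Fˣ) (a * (1 + b) / b)) := by
  have h := equivalent_binaryForm_one_add hb (hd ▸ d.ne_zero) a
  refine QuadraticMap.Equivalent.trans ?_ (equivalent_quadPfister_cons d α _).symm
  simp only [quadPfister, smul_diagTensor, hd]
  exact (equivalent_diagTensor_prod _ _ _).symm.trans
    ((equivalent_diagTensor _ h).trans (equivalent_diagTensor_prod _ _ _))

/-- The nonzero values of an anisotropic round form `Q` are closed under division, so that an
isotropic `⟨1, c⟩ ⊗ Q` exhibits `c` as a value of `Q`. -/
theorem IsRound.exists_eq_of_not_anisotropic {M : Type*} [AddCommGroup M] [Module F M]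
    {Q : QuadraticForm F M} (hQ : IsRound Q) (hA : Q.Anisotropic) {c : F}
    (h : ¬ (Q.prod (c • Q)).Anisotropic) : ∃ z, Q z = c := by
  obtain ⟨x, y, h0, hne⟩ := exists_of_not_anisotropic_prod_smul h
  have hy : Q y ≠ 0 := fun hy => by
    rw [hy, mul_zero, add_zero] at h0
    exact hne ⟨hA x h0, hA y hy⟩
  have hx : Q x = c * Q y := CharTwo.add_eq_zero.1 h0
  obtain ⟨e⟩ := equivalent_inv_smul hy (hQ y hy)
  refine ⟨e x, ?_⟩
  rw [e.map_app, _root_.smul_apply, hx, smul_eq_mul]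
  field_simp

theorem exists_equivalent_of_not_anisotropic {m : ℕ} (β γ : Fˣ) (α : Fin m → Fˣ) (a : F)
    (h : ¬ (quadPfister
      (Fin.cons γ (Fin.cons β α : Fin (m + 1) → Fˣ) : Fin (m + 2) → Fˣ) a).Anisotropic) :
    ∃ (c : Fin (m + 1) → Fˣ) (x y : F),
      (quadPfister (Fin.cons β α : Fin (m + 1) → Fˣ) a).Equivalent (quadPfister c x) ∧
      (quadPfister (Fin.cons γ α : Fin (m + 1) → Fˣ) a).Equivalent (quadPfister c y) := by
  have eφ := equivalent_quadPfister_cons β α a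
  have eψ := equivalent_quadPfister_cons γ α a
  by_cases hφ : (quadPfister (Fin.cons β α : Fin (m + 1) → Fˣ) a).Anisotropic
  swap
  · exact ⟨_, 0, a,
      equivalent_quadPfister_zero_of_not_anisotropic hφ _,
      QuadraticMap.Equivalent.refl _⟩
  by_cases hψ : (quadPfister (Fin.cons γ α : Fin (m + 1) → Fˣ) a).Anisotropic
  swap
  · exact ⟨_, a, 0, QuadraticMap.Equivalent.refl _,
      equivalent_quadPfister_zero_of_not_anisotropic hψ _⟩
  obtain ⟨z, hz⟩ := (isRound_quadPfister _ a).exists_eq_of_not_anisotropic hφ fun h' =>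
    h (anisotropic_of_equivalent (equivalent_quadPfister_cons γ _ a).symm h')
  have hR := isRound_quadPfister α a
  obtain ⟨u, v, hγ⟩ : ∃ u v, (γ : F) = quadPfister α a u + β * quadPfister α a v := by
    obtain ⟨e⟩ := eφ
    exact ⟨(e z).1, (e z).2, by rw [← hz, ← e.map_app]; rfl⟩
  by_cases hu : quadPfister α a u = 0
  · -- Here `γ` is `β` times a similarity factor, so the two forms are isometric.
    rw [hu, zero_add] at hγ
    have hv : quadPfister α a v ≠ 0 := fun hv => γ.ne_zero (by rw [hγ, hv, mul_zero])
    refine ⟨Fin.cons β α, a, a, QuadraticMap.Equivalent.refl _, (eψ.trans ?_).trans eφ.symm⟩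
    rw [hγ]
    exact equivalent_prod_smul_mul _ (hR v hv)
  by_cases hv : quadPfister α a v = 0
  · -- Here `γ` is a value of the common right divisor, so the second form is isotropic.
    rw [hv, mul_zero, add_zero] at hγ
    obtain ⟨p, hp⟩ := exists_quadPfister_eq_one α a
    have := anisotropic_of_equivalent eψ hψ (u, p) (by simp [hp, hγ, CharTwo.add_self_eq_zero])
    obtain rfl : u = 0 := congrArg Prod.fst this
    exact absurd (QuadraticMap.map_zero _) hu
  · -- Modulo similarity factors of the common right divisor, `γ = 1 + β`.
    set r := quadPfister α a u
    set t := quadPfister α a v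
    have hr' := equivalent_inv_smul hu (hR u hu)
    have hb : (β : F) * (t * r⁻¹) ≠ 0 :=
      mul_ne_zero β.ne_zero (mul_ne_zero hv (inv_ne_zero hu))
    have hd : (γ : F) * r⁻¹ = 1 + β * (t * r⁻¹) := by
      rw [hγ, add_mul, mul_inv_cancel₀ hu, mul_assoc]
    refine ⟨Fin.cons (Units.mk0 (γ * r⁻¹) (mul_ne_zero γ.ne_zero (inv_ne_zero hu))) α,
      a * (1 + β * (t * r⁻¹)) / (β * (t * r⁻¹)), a, ?_, ?_⟩
    · exact (eφ.trans (equivalent_prod_smul_mul _ (equivalent_mul_smul (hR v hv) hr')).symm).trans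
        (equivalent_prod_smul_quadPfister_one_add hb _ hd α a)
    · exact (eψ.trans (equivalent_prod_smul_mul _ hr').symm).trans
        (equivalent_quadPfister_cons (Units.mk0 _ _) α a).symm

end Linkage

/-! ### From left linkage to an isotropic Pfister form -/

section Converse

variable {F : Type*} [Field F]

theorem separatingLeft_polarBilin_diagTensor {ι : Type*} [Fintype ι] [CharP F 2] (w : ι → Fˣ)
    (a : F) : (diagTensor w (binaryForm 1 a)).polarBilin.SeparatingLeft := by
  classical
  have h2 : (2 : F) = 0 := CharTwo.two_eq_zero
  intro x hx
  have key (i : ι) (p : F × F) : w i * QuadraticMap.polar (binaryForm 1 a) (x i) p = 0 := by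
    have := hx (Pi.single i p)
    rw [polarBilin_apply_apply, polar, diagTensor, QuadraticMap.pi_apply, QuadraticMap.pi_apply,
      QuadraticMap.pi_apply, ← Finset.sum_sub_distrib, ← Finset.sum_sub_distrib,
      Fintype.sum_eq_single i fun j hj => by simp [Pi.single_eq_of_ne hj]] at this
    rw [← this]
    simp [polar, mul_sub]
  funext i
  have h1 := key i (1, 0)
  have h3 := key i (0, 1)
  simp [QuadraticMap.polar] at h1 h3
  ext
  · simp only [Pi.zero_apply, Prod.fst_zero]
    linear_combination h3 - a * (x i).2 * h2
  · simp only [Pi.zero_apply, Prod.snd_zero]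
    linear_combination h1 - (x i).1 * h2

/-- Let `(i₁, i₂)` and `(j₁, j₂)` embed one totally singular form `h` representing `1` into
`⟨1, β⟩ ⊗ Q` and `⟨1, γ⟩ ⊗ Q`, where `h` has the same dimension as `Q`. If `⟨β, γ⟩ ⊗ Q` is
anisotropic then it represents `1`. -/
theorem exists_add_eq_one_of_common_subform [CharP F 2] {V B : Type*} [AddCommGroup V] [Module F V]
    [AddCommGroup B] [Module F B] [FiniteDimensional F V] [FiniteDimensional F B]
    {Q : QuadraticForm F V} (hQ : Q.polarBilin.SeparatingLeft)
    (hdim : Module.finrank F B = Module.finrank F V) {β γ : F} {i₁ i₂ j₁ j₂ : B →ₗ[F] V}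
    {h : B → F} (hadd : ∀ s t, h (s + t) = h s + h t)
    (hi : ∀ s, Q (i₁ s) + β * Q (i₂ s) = h s) (hj : ∀ s, Q (j₁ s) + γ * Q (j₂ s) = h s)
    (hinj : ∀ s, i₁ s = 0 → i₂ s = 0 → s = 0) {e : B} (he : h e = 1)
    (hne : ∀ u v, β * Q u = γ * Q v → u = 0 ∧ v = 0) :
    ∃ u v, β * Q u + γ * Q v = 1 := by
  have hi' (s t) : polar Q (i₁ s) (i₁ t) + β * polar Q (i₂ s) (i₂ t) = 0 := by
    have := hadd s t
    rw [← hi, ← hi, ← hi, map_add i₁, map_add i₂] at this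
    simp only [polar]
    linear_combination this
  have hj' (s t) : polar Q (j₁ s) (j₁ t) + γ * polar Q (j₂ s) (j₂ t) = 0 := by
    have := hadd s t
    rw [← hj, ← hj, ← hj, map_add j₁, map_add j₂] at this
    simp only [polar]
    linear_combination this
  have hself (v : V) : v + v = 0 := by
    rw [← two_smul F, CharTwo.two_eq_zero, zero_smul]
  -- On the kernel of `i₁ + j₁` the embeddings agree and have no second component.
  set K := LinearMap.ker (i₁ + j₁)
  have hK (s) (hs : s ∈ K) : i₁ s = j₁ s ∧ i₂ s = 0 ∧ j₂ s = 0 := by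
    have h1 : i₁ s + j₁ s = 0 := hs
    have h2 : i₁ s = j₁ s := by
      calc i₁ s = (i₁ s + j₁ s) + j₁ s := by rw [add_assoc, hself, add_zero]
        _ = j₁ s := by rw [h1, zero_add]
    refine ⟨h2, hne _ _ ?_⟩
    have := hi s
    rw [← hj s, h2] at this
    exact add_left_cancel this
  -- Hence the range of `i₁ + j₁` is orthogonal to `i₁ K`, and it has the right dimension.
  have hrange : LinearMap.range (i₁ + j₁) = LinearMap.BilinForm.orthogonal Q.polarBilin
      (K.map i₁) := by
    refine Submodule.eq_of_le_of_finrank_eq ?_ ?_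
    · rintro _ ⟨t, rfl⟩
      rw [LinearMap.BilinForm.mem_orthogonal_iff]
      rintro _ ⟨s, hs, rfl⟩
      obtain ⟨h1, h2, h3⟩ := hK s hs
      have e1 := hi' s t
      have e2 := hj' s t
      rw [h2, polar_zero_left, mul_zero, add_zero] at e1
      rw [h3, ← h1, polar_zero_left, mul_zero, add_zero] at e2
      rw [polarBilin_apply_apply, LinearMap.add_apply, polar_add_right, e1, e2, add_zero]
    · have hrefl : (Q.polarBilin).IsRefl := fun x y hxy => by
        rwa [polarBilin_apply_apply, polar_comm]
      rw [LinearMap.BilinForm.finrank_orthogonal (hrefl.nondegenerate_iff_separatingLeft.2 hQ)]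
      have hr := LinearMap.finrank_range_add_finrank_ker (i₁ + j₁)
      have hm : Module.finrank F (K.map i₁) = Module.finrank F K := by
        rw [← LinearMap.range_domRestrict]
        refine LinearMap.finrank_range_of_inj ?_
        rw [injective_iff_map_eq_zero]
        exact fun s hs => Subtype.ext (hinj _ hs (hK s s.2).2.1)
      change _ + Module.finrank F K = _ at hr
      omega
  obtain ⟨s, hs⟩ : j₁ e ∈ LinearMap.range (i₁ + j₁) := by
    rw [hrange, LinearMap.BilinForm.mem_orthogonal_iff]
    rintro _ ⟨t, ht, rfl⟩
    obtain ⟨h1, h2, h3⟩ := hK t ht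
    have e2 := hj' t e
    rwa [h3, ← h1, polar_zero_left, mul_zero, add_zero] at e2
  refine ⟨i₂ s, j₂ (s + e), ?_⟩
  have h1 : i₁ s = j₁ (s + e) := by
    rw [map_add, ← hs, LinearMap.add_apply, add_left_comm, hself, add_zero]
  have e1 := hi s
  have e2 := hj (s + e)
  rw [hadd, he, ← h1] at e2
  have h2 : (2 : F) = 0 := CharTwo.two_eq_zero
  linear_combination e1 + e2 - (Q (i₁ s) - h s) * h2

/-- A divisor `b` on the left embeds the totally singular form `s ↦ b(s, s)`. -/
theorem exists_totallySingular_subform {ι M : Type*} [Fintype ι] [AddCommGroup M] [Module F M]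
    (w : ι → Fˣ) (x β : F) {Q : QuadraticForm F M}
    (h : (diagTensor w (binaryForm 1 x)).Equivalent (Q.prod (β • Q))) :
    ∃ i₁ i₂ : (ι → F) →ₗ[F] M, (∀ s, Q (i₁ s) + β * Q (i₂ s) = ∑ k, w k * s k ^ 2) ∧
      ∀ s, i₁ s = 0 → i₂ s = 0 → s = 0 := by
  obtain ⟨e⟩ := h
  let f : (ι → F) →ₗ[F] M × M :=
    e.toLinearEquiv.toLinearMap ∘ₗ LinearMap.compLeft (LinearMap.inl F F F) ι
  have hf (s) : f s = e fun k => (s k, 0) := rfl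
  refine ⟨LinearMap.fst F M M ∘ₗ f, LinearMap.snd F M M ∘ₗ f, fun s => ?_, fun s h1 h2 => ?_⟩
  · have := e.map_app fun k => (s k, 0)
    rw [← hf] at this
    simpa using this
  · have h0 : f s = 0 := Prod.ext h1 h2
    rw [hf] at h0
    have h3 : (fun k => (s k, (0 : F))) = 0 := e.toLinearEquiv.map_eq_zero_iff.1 h0
    funext k
    exact congrArg Prod.fst (congrFun h3 k)

theorem not_anisotropic_of_equivalent [CharP F 2] {m : ℕ} {β γ : Fˣ} {α : Fin m → Fˣ} {a : F}
    {c : Fin (m + 1) → Fˣ} {x y : F}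
    (hφ : (quadPfister (Fin.cons β α : Fin (m + 1) → Fˣ) a).Equivalent (quadPfister c x))
    (hψ : (quadPfister (Fin.cons γ α : Fin (m + 1) → Fˣ) a).Equivalent (quadPfister c y)) :
    ¬ (quadPfister
      (Fin.cons γ (Fin.cons β α : Fin (m + 1) → Fˣ) : Fin (m + 2) → Fˣ) a).Anisotropic := by
  classical
  intro hA
  have hA' : ∀ p u v, quadPfister α a p + β * quadPfister α a u + γ * quadPfister α a v = 0 →
      p = 0 ∧ u = 0 ∧ v = 0 := by
    intro p u v h0
    have e := equivalent_quadPfister_cons β α a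
    have := anisotropic_of_equivalent ((equivalent_quadPfister_cons γ _ a).trans
      (e.prod (equivalent_smul (γ : F) e))) hA ((p, u), (v, 0)) (by simpa using h0)
    simpa [Prod.ext_iff, and_assoc] using this
  obtain ⟨i₁, i₂, hi, hinj⟩ := exists_totallySingular_subform (bilinPfister c) x β
    (hφ.symm.trans (equivalent_quadPfister_cons β α a))
  obtain ⟨j₁, j₂, hj, -⟩ := exists_totallySingular_subform (bilinPfister c) y γ
    (hψ.symm.trans (equivalent_quadPfister_cons γ α a))
  obtain ⟨u, v, huv⟩ := exists_add_eq_one_of_common_subform (β := (β : F)) (γ := (γ : F))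
    (separatingLeft_polarBilin_diagTensor (bilinPfister α) a)
    (by simp [Module.finrank_pi_fintype, pow_succ])
    (h := fun s => ∑ k, (bilinPfister c k : F) * s k ^ 2)
    (fun s t => by simp [CharTwo.add_sq, mul_add, Finset.sum_add_distrib]) hi hj hinj
    (e := Pi.single 0 1)
    (by
      rw [Fintype.sum_eq_single 0 fun k hk => by simp [Pi.single_eq_of_ne hk]]
      simp [bilinPfister])
    (fun u v h => (hA' 0 u v (by
      rw [map_zero, zero_add]
      exact CharTwo.add_eq_zero.2 h)).2)
  obtain ⟨p, hp⟩ := exists_quadPfister_eq_one α a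
  have h0 := hA' p u v (by
    rw [hp, add_assoc]
    exact CharTwo.add_eq_zero.2 huv.symm)
  rw [h0.1, map_zero] at hp
  exact zero_ne_one hp

end Converse

end QuadPfister

/-- Here `n = m + 2` runs over all integers `n ≥ 2`; the slots `α₁, …, α_{n-2}` are the units
`α i`, and `a ∈ F` is the last slot `α_{n-1}`. -/
theorem mainTheorem2 {F : Type*} [Field F] [CharP F 2] (m : ℕ) (β γ : Fˣ)
    (α : Fin m → Fˣ) (a : F) :
    QuadPfister.IsLeftLinked (m + 2)
        {QuadPfister.quadPfister (Fin.cons β α : Fin (m + 1) → Fˣ) a,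
          QuadPfister.quadPfister (Fin.cons γ α : Fin (m + 1) → Fˣ) a} ↔
      QuadPfister.IsHyperbolic
        (QuadPfister.quadPfister
          (Fin.cons γ (Fin.cons β α : Fin (m + 1) → Fˣ) : Fin (m + 2) → Fˣ) a) := by
  constructor
  · rintro ⟨c, hc⟩
    obtain ⟨x, hx⟩ := hc _ (Set.mem_insert _ _)
    obtain ⟨y, hy⟩ := hc _ (Set.mem_insert_of_mem _ rfl)
    exact QuadPfister.isHyperbolic_quadPfister _ _
      (QuadPfister.not_anisotropic_of_equivalent (c := c) hx hy)
  · intro h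
    obtain ⟨c, x, y, hx, hy⟩ :=
      QuadPfister.exists_equivalent_of_not_anisotropic β γ α a h.not_anisotropic
    refine ⟨c, ?_⟩
    rintro φ (rfl | rfl)
    · exact ⟨x, hx⟩
    · exact ⟨y, hy⟩
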